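/- Let $G$ be a finite median graph, i.e. a finite simple graph in which every triple $u,v,w$ of vertices has a unique median (a vertex lying simultaneously on a shortest $u,v$-path, a shortest $u,w$-path and a shortest $v,w$-path). Let $Q_i$ be the $i$-dimensional hypercube, let $\alpha_i(G)$ be the number of induced subgraphs of $G$ isomorphic to $Q_i$, let $m$ be the largest $i$ with $\alpha_i(G)>0$ ($m=0$ if $G$ has no vertices), and let $C(G,x)=\sum_{i\ge 0}\alpha_i(G)x^i$ be the cube polynomial. Write $C(G,x)=\sum_{i\ge 0} b_i(G)(x+1)^i$; this determines the coefficients $b_i(G)$. For a finite graph $H$ whose components are median graphs, two edges $xy$ and $zw$ in the same component are in relation $\Theta$ if $d(x,z)+d(y,w)\neq d(x,w)+d(y,z)$; edges in different components are not related. For an edge $ab$, let $W_{ab}$ be the set of vertices $w$ in the component of $ab$ with $d(w,a)<d(w,b)$, and let $U_{ab}$ be the set of vertices of $W_{ab}$ having a neighbour in $W_{ba}$. The derivative graph $\partial H$ is the disjoint union, over all $\Theta$-classes of edges of $H$, of the subgraphs of $H$ induced by $U_{ab}$, where $ab$ is an (arbitrarily chosen and oriented) edge of the class. Put $\partial^0G=G$,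 $\partial^{i+1}G=\partial(\partial^iG)$, and let $\theta_i(G)$ be the number of connected components of $\partial^iG$. Then $b_i(G)=\theta_i(G)/i!$ for every $i\ge 0$. Moreover $\theta_i(G)=0$ for $i>m$, and $$C(G,x)=\sum_{i\ge 0}\frac{\theta_i(G)}{i!}(x+1)^i=\sum_{i=0}^{m}\frac{\theta_i(G)}{i!}(x+1)^i .$$ -/

import Mathlib

namespace CubePolynomial

universe u

/-- The `n`-cube `Q_n`: binary strings of length `n`, adjacent iff they differ in exactly one
position. -/
def hypercube (n : ℕ) : SimpleGraph (Fin n → Bool) where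
  Adj x y := hammingDist x y = 1
  symm := ⟨fun x y h => by rw [hammingDist_comm]; exact h⟩
  loopless := ⟨fun x h => by simp at h⟩

/-- `α_n(G)`: the number of induced subgraphs of `G` isomorphic to `Q_n`. -/
noncomputable def cubeCount {V : Type u} (G : SimpleGraph V) (n : ℕ) : ℕ :=
  {S : Set V | Nonempty (G.induce S ≃g hypercube n)}.ncard

/-- The maximum dimension of a hypercube that occurs as an induced subgraph of a finite graph
`G`. -/
noncomputable def cubeDim {V : Type u} (G : SimpleGraph V) : ℕ :=
  sSup {n : ℕ | ∃ S : Set V, Nonempty (G.induce S ≃g hypercube n)}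

/-- The cube polynomial `C(G, x) = ∑ α_i(G) x ^ i` of a finite graph; all terms with
`i > cubeDim G` vanish. -/
noncomputable def cubePoly {V : Type u} (G : SimpleGraph V) : Polynomial ℚ :=
  ∑ i ∈ Finset.range (cubeDim G + 1), Polynomial.monomial i (cubeCount G i : ℚ)

/-- `b_i(G)`: the coefficient of `(x + 1) ^ i` when `C(G, x)` is written in powers of `x + 1`,
that is, the coefficient of `y ^ i` in `C(G, y - 1)`. -/
noncomputable def shiftedCoeff {V : Type u} (G : SimpleGraph V) (i : ℕ) : ℚ :=
  ((cubePoly G).comp (Polynomial.X - 1)).coeff i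

/-- `m` lies on a shortest path from `u` to `v`. -/
def OnGeodesic {V : Type u} (G : SimpleGraph V) (u v m : V) : Prop :=
  ∃ p : G.Walk u v, p.length = G.dist u v ∧ m ∈ p.support

/-- A median graph: every triple of vertices has a unique median. In particular any two vertices
are joined by a path. -/
def IsMedian {V : Type u} (G : SimpleGraph V) : Prop :=
  ∀ u v w : V, ∃! m : V, OnGeodesic G u v m ∧ OnGeodesic G u w m ∧ OnGeodesic G v w m

/-- The Djoković–Winkler relation `Θ` for edges `e = xy` and `f = zw`:
`d(x,z) + d(y,w) ≠ d(x,w) + d(y,z)`. It is written on oriented edges, but does not depend on the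
orientations, and an oriented edge is related to itself and to its reversal. Edges in different
components are never related (all distances involved have the value `0`). -/
def Theta {V : Type u} (G : SimpleGraph V) (e f : G.Dart) : Prop :=
  G.dist e.fst f.fst + G.dist e.snd f.snd ≠ G.dist e.fst f.snd + G.dist e.snd f.fst

/-- The `Θ`-classes of edges: classes of the equivalence relation generated by `Θ` (which in a graph
with median components is `Θ` itself). -/
def ThetaClass {V : Type u} (G : SimpleGraph V) : Type u :=
  Quot (Theta G)

/-- `W_{ab}`: the vertices closer to `a` than to `b`. -/
def W {V : Type u} (G : SimpleGraph V) (a b : V) : Set V :=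
  {w | G.dist w a < G.dist w b}

/-- `U_{ab}`: the vertices of `W_{ab}` that have a neighbour in `W_{ba}`. -/
def U {V : Type u} (G : SimpleGraph V) (a b : V) : Set V :=
  {w | w ∈ W G a b ∧ ∃ z ∈ W G b a, G.Adj w z}

/-- A representative oriented edge `ab` of a `Θ`-class. For graphs with median components the graph
induced by `U_{ab}` does not depend, up to isomorphism, on this choice. -/
noncomputable def ThetaClass.rep {V : Type u} {G : SimpleGraph V} (c : ThetaClass G) : G.Dart :=
  Quot.out c

/-- The vertices of `∂G`: the disjoint union of the sets `U_{ab}`, one for each `Θ`-class. -/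
def DerivVertex {V : Type u} (G : SimpleGraph V) : Type u :=
  Σ c : ThetaClass G, U G c.rep.fst c.rep.snd

/-- The derivative graph `∂G`: the disjoint union, over the `Θ`-classes of `G`, of the subgraphs of
`G` induced by `U_{ab}`, where `ab` is an edge of the class. -/
def derivGraph {V : Type u} (G : SimpleGraph V) : SimpleGraph (DerivVertex G) where
  Adj p q := p.1 = q.1 ∧ G.Adj (p.2 : V) (q.2 : V)
  symm := ⟨fun _ _ h => ⟨h.1.symm, h.2.symm⟩⟩
  loopless := ⟨fun _ h => G.irrefl h.2⟩

/-- The iterated derivative graph `∂^i G` together with its vertex type: `∂^0 G = G` and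
`∂^{i+1} G = ∂(∂^i G)`. -/
noncomputable def iterDeriv {V : Type u} (G : SimpleGraph V) : ℕ → Σ W : Type u, SimpleGraph W
  | 0 => ⟨V, G⟩
  | i + 1 => ⟨DerivVertex (iterDeriv G i).2, derivGraph (iterDeriv G i).2⟩

/-- `θ_i(G)`: the number of connected components of `∂^i G`. -/
noncomputable def theta {V : Type u} (G : SimpleGraph V) (i : ℕ) : ℕ :=
  Nat.card (iterDeriv G i).2.ConnectedComponent

/-- The iterated derivatives of a finite graph are finite, so that `theta` is an honest count. -/
theorem finite_iterDeriv {V : Type u} [Finite V] (G : SimpleGraph V) (i : ℕ) :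
    Finite (iterDeriv G i).1 := by
  induction i with
  | zero => assumption
  | succ i ih =>
    have : Finite (iterDeriv G i).2.Dart :=
      Finite.of_injective (fun d => d.toProd) SimpleGraph.Dart.toProd_injective
    have : Finite (ThetaClass (iterDeriv G i).2) := inferInstanceAs (Finite (Quot _))
    exact inferInstanceAs (Finite (Sigma _))

end CubePolynomial

namespace CubePolynomial

/-! Two identities carry the theorem: `C'(G, x) = C(∂G, x)`, and `C(G, -1)` is the number of
components of `G`. Iterating the first and evaluating with the second shows that the `i`-th
derivative of `C(G, x)` at `-1` is `θ_i(G)`; Taylor expansion at `-1` does the rest. Since `∂G` is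
usually disconnected, everything is proved for graphs with median components, a class closed under
`∂` because each `U_{ab}` is convex (`HasMedianComponents.derivGraph`).

The first identity is a double count (`HasMedianComponents.cubeCount_derivGraph`). The edges between
`W_{ab}` and `W_{ba}` form a matching that preserves adjacency, so a cube meeting both sides is a
prism over a cube of one lower dimension in `U_{ab}`. An `(n+1)`-cube is split in this way by
exactly `n+1` Θ-classes.

The second is an Euler characteristic computation (`HasMedianComponents.eulerChar_eq_one`). Cutting
a convex set `S` along `ab` gives `χ(S) = χ(S ∩ W_{ab}) + χ(S ∩ W_{ba}) - χ(S ∩ U_{ab})`, with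
smaller convex pieces on the right, so `χ = 1` by induction. -/

variable {V : Type*} {G : SimpleGraph V}

/-! ### Geodesics and median components -/

/-- `m` lies metrically between `u` and `v`, all three in one component. -/
def Between (G : SimpleGraph V) (u m v : V) : Prop :=
  G.Reachable u m ∧ G.Reachable m v ∧ G.dist u m + G.dist m v = G.dist u v

/-- Every component of `G` is a median graph. -/
def HasMedianComponents (G : SimpleGraph V) : Prop :=
  ∀ u v w : V, G.Reachable u v → G.Reachable u w →
    ∃! m : V, Between G u m v ∧ Between G u m w ∧ Between G v m w

theorem dist_triangle_of_reachable {u v : V} (h : G.Reachable u v) (w : V) :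
    G.dist u w ≤ G.dist u v + G.dist v w := h.dist_triangle_left w

theorem exists_adj_closer {u v : V} (h : G.Reachable u v) (hne : u ≠ v) :
    ∃ u', G.Adj u u' ∧ G.dist u' v + 1 = G.dist u v := by
  obtain ⟨p, hp⟩ := h.exists_walk_length_eq_dist
  cases p with
  | nil => exact absurd rfl hne
  | @cons _ u' _ hadj q =>
    refine ⟨u', hadj, ?_⟩
    have h1 := SimpleGraph.dist_le q
    have h2 := dist_triangle_of_reachable hadj.reachable v
    rw [SimpleGraph.dist_eq_one_iff_adj.2 hadj] at h2
    simp only [SimpleGraph.Walk.length_cons] at hp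
    omega

theorem onGeodesic_iff_between {u v m : V} : OnGeodesic G u v m ↔ Between G u m v := by
  classical
  constructor
  · rintro ⟨p, hp, hm⟩
    have h1 := SimpleGraph.dist_le (p.takeUntil m hm)
    have h2 := SimpleGraph.dist_le (p.dropUntil m hm)
    have h3 := congrArg SimpleGraph.Walk.length (p.take_spec hm)
    rw [SimpleGraph.Walk.length_append] at h3
    have hr : G.Reachable u m := ⟨p.takeUntil m hm⟩
    have h4 := dist_triangle_of_reachable hr v
    exact ⟨hr, ⟨p.dropUntil m hm⟩, by omega⟩
  · rintro ⟨h1, h2, h3⟩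
    obtain ⟨p, hp⟩ := h1.exists_walk_length_eq_dist
    obtain ⟨q, hq⟩ := h2.exists_walk_length_eq_dist
    refine ⟨p.append q, by rw [SimpleGraph.Walk.length_append]; omega, ?_⟩
    simp

theorem IsMedian.hasMedianComponents (hG : IsMedian G) : HasMedianComponents G := by
  intro u v w _ _
  simpa only [onGeodesic_iff_between] using hG u v w

/-! ### Bipartiteness and the quadrangle condition -/

/-- Components of a graph with median components are bipartite. -/
theorem HasMedianComponents.dist_adj (hG : HasMedianComponents G) {a b w : V} (hab : G.Adj a b)
    (h : G.Reachable w a) : G.dist w a = G.dist w b + 1 ∨ G.dist w b = G.dist w a + 1 := by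
  obtain ⟨m, ⟨h1, h2, h3⟩, -⟩ := hG a b w hab.reachable h.symm
  have e1 := SimpleGraph.dist_eq_one_iff_adj.2 hab
  have e2 := SimpleGraph.dist_eq_one_iff_adj.2 hab.symm
  have c1 := G.dist_comm (u := w) (v := a)
  have c2 := G.dist_comm (u := w) (v := b)
  have h1' := h1.2.2
  rw [e1] at h1'
  -- A median of `a`, `b`, `w` lies on the edge `ab`, so it is `a` or `b`.
  rcases Nat.eq_zero_or_pos (G.dist a m) with h0 | h0
  · obtain rfl := h1.1.dist_eq_zero_iff.1 h0
    have := h3.2.2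
    omega
  · have h0' : G.dist m b = 0 := by omega
    obtain rfl := h1.2.1.dist_eq_zero_iff.1 h0'
    have := h2.2.2
    omega

theorem HasMedianComponents.dist_eq_two (hG : HasMedianComponents G) {w x y b : V}
    (hx : G.Adj w x) (hy : G.Adj w y) (hne : x ≠ y) (hb : G.Reachable w b)
    (hxy : G.dist x b = G.dist y b) : G.dist x y = 2 := by
  have hr : G.Reachable x y := hx.symm.reachable.trans hy.reachable
  have h1 := dist_triangle_of_reachable hx.symm.reachable y
  rw [SimpleGraph.dist_eq_one_iff_adj.2 hx.symm, SimpleGraph.dist_eq_one_iff_adj.2 hy] at h1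
  have h2 := hr.pos_dist_of_ne hne
  have h3 : G.dist x y ≠ 1 := by
    intro h
    have := hG.dist_adj (SimpleGraph.dist_eq_one_iff_adj.1 h) (hb.symm.trans hx.reachable)
    have c1 := G.dist_comm (u := b) (v := x)
    have c2 := G.dist_comm (u := b) (v := y)
    omega
  omega

/-- The quadrangle condition. -/
theorem HasMedianComponents.quadrangle (hG : HasMedianComponents G) {w x y b : V}
    (hx : G.Adj w x) (hy : G.Adj w y) (hne : x ≠ y) (hb : G.Reachable w b)
    (hwx : G.dist w b = G.dist x b + 1) (hwy : G.dist w b = G.dist y b + 1) :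
    ∃ z, G.Adj x z ∧ G.Adj y z ∧ G.dist z b + 1 = G.dist x b := by
  have h2 := hG.dist_eq_two hx hy hne hb (by omega)
  -- As `d(x,y) = 2` and `x`, `y` are equidistant from `b`, the median of `x`, `y`, `b` is at
  -- distance one from both.
  obtain ⟨z, ⟨h3, h4, h5⟩, -⟩ :=
    hG x y b (hx.symm.reachable.trans hy.reachable) (hx.symm.reachable.trans hb)
  have c := G.dist_comm (u := z) (v := y)
  have e3 := h3.2.2
  have e4 := h4.2.2
  have e5 := h5.2.2
  exact ⟨z, SimpleGraph.dist_eq_one_iff_adj.1 (by omega),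
    SimpleGraph.dist_eq_one_iff_adj.1 (by omega), by omega⟩

/-- Two vertices equidistant from `b` have at most one common neighbour that is closer to `b`. -/
theorem HasMedianComponents.common_neighbor_unique (hG : HasMedianComponents G)
    {x y z z' b : V} (hne : x ≠ y) (hb : G.Reachable x b) (hxz : G.Adj x z) (hyz : G.Adj y z)
    (hxz' : G.Adj x z') (hyz' : G.Adj y z') (hx : G.dist x b = G.dist z b + 1)
    (hy : G.dist y b = G.dist z b + 1) (hz : G.dist z' b = G.dist z b) : z = z' := by
  have h2 := hG.dist_eq_two hxz.symm hyz.symm hne (hxz.symm.reachable.trans hb) (by omega)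
  have hxy : G.Reachable x y := hxz.reachable.trans hyz.symm.reachable
  -- Both `z` and `z'` are medians of `x`, `y`, `b`.
  refine (hG x y b hxy hb).unique (y₁ := z) (y₂ := z') ?_ ?_
  all_goals
    refine ⟨⟨?_, ?_, ?_⟩, ⟨?_, ?_, ?_⟩, ⟨?_, ?_, ?_⟩⟩
  all_goals first
    | exact hxz.reachable
    | exact hxz'.reachable
    | exact hyz.reachable
    | exact hyz'.reachable
    | exact hyz.symm.reachable
    | exact hyz'.symm.reachable
    | exact hxz.symm.reachable.trans hb
    | exact hxz'.symm.reachable.trans hb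
    | (have e1 := SimpleGraph.dist_eq_one_iff_adj.2 hxz
       have e2 := SimpleGraph.dist_eq_one_iff_adj.2 hyz
       have e3 := SimpleGraph.dist_eq_one_iff_adj.2 hxz'
       have e4 := SimpleGraph.dist_eq_one_iff_adj.2 hyz'
       have e5 := SimpleGraph.dist_eq_one_iff_adj.2 hyz.symm
       have e6 := SimpleGraph.dist_eq_one_iff_adj.2 hyz'.symm
       omega)

/-! ### Half-spaces and the edges crossing between them -/

theorem mem_W_dist {a b w : V} (hab : G.Adj a b) (hw : w ∈ W G a b) :
    G.Reachable w a ∧ G.dist w b = G.dist w a + 1 := by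
  have hw : G.dist w a < G.dist w b := hw
  have hr : G.Reachable w b := SimpleGraph.Reachable.of_dist_ne_zero (by omega)
  have h := dist_triangle_of_reachable (hr.trans hab.symm.reachable) b
  rw [SimpleGraph.dist_eq_one_iff_adj.2 hab] at h
  exact ⟨hr.trans hab.symm.reachable, by omega⟩

theorem not_mem_W_of_mem_W_swap {a b w : V} (h : w ∈ W G b a) : w ∉ W G a b :=
  fun h' => lt_asymm (show G.dist w b < G.dist w a from h) h'

theorem HasMedianComponents.mem_W_or (hG : HasMedianComponents G) {a b w : V} (hab : G.Adj a b)
    (h : G.Reachable w a) : w ∈ W G a b ∨ w ∈ W G b a := by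
  simp only [W, Set.mem_ofPred_eq]
  have := hG.dist_adj hab h
  omega

theorem left_mem_W {a b : V} (hab : G.Adj a b) : a ∈ W G a b := by
  simp [W, SimpleGraph.dist_eq_one_iff_adj.2 hab]

/-- The edge `wz` runs from `W_{ab}` to `W_{ba}`. -/
structure Crosses (G : SimpleGraph V) (a b w z : V) : Prop where
  adj : G.Adj w z
  left : w ∈ W G a b
  right : z ∈ W G b a

theorem Crosses.symm {a b w z : V} (h : Crosses G a b w z) : Crosses G b a z w :=
  ⟨h.adj.symm, h.right, h.left⟩

theorem Crosses.refl {a b : V} (hab : G.Adj a b) : Crosses G a b a b :=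
  ⟨hab, left_mem_W hab, left_mem_W hab.symm⟩

theorem mem_U_iff {a b w : V} : w ∈ U G a b ↔ ∃ z, Crosses G a b w z :=
  ⟨fun ⟨h1, z, h2, h3⟩ => ⟨z, h3, h1, h2⟩, fun ⟨z, h⟩ => ⟨h.left, z, h.right, h.adj⟩⟩

theorem Crosses.dist_eq {a b w z : V} (hab : G.Adj a b) (h : Crosses G a b w z) :
    G.dist z b = G.dist w a := by
  obtain ⟨r1, e1⟩ := mem_W_dist hab h.left
  obtain ⟨r2, e2⟩ := mem_W_dist hab.symm h.right
  have t1 := dist_triangle_of_reachable h.adj.reachable b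
  have t2 := dist_triangle_of_reachable h.adj.symm.reachable a
  rw [SimpleGraph.dist_eq_one_iff_adj.2 h.adj] at t1
  rw [SimpleGraph.dist_eq_one_iff_adj.2 h.adj.symm] at t2
  omega

theorem HasMedianComponents.mem_W_swap_of_adj (hG : HasMedianComponents G) {a b w z : V}
    (hab : G.Adj a b) (hw : w ∈ W G a b) (hwz : G.Adj w z) (hz : z ∉ W G a b) : z ∈ W G b a :=
  (hG.mem_W_or hab (hwz.symm.reachable.trans (mem_W_dist hab hw).1)).resolve_left hz

/-- Both `w'` and `z` are neighbours of `w` closer to `b`; the quadrangle condition completes the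
square. Repeating this moves a crossing edge rung by rung down to `ab`. -/
theorem HasMedianComponents.crosses_ladder (hG : HasMedianComponents G) {a b w z w' : V}
    (hab : G.Adj a b) (h : Crosses G a b w z) (hw : G.Adj w w')
    (hd : G.dist w' a + 1 = G.dist w a) : ∃ z', Crosses G a b w' z' ∧ G.Adj z z' := by
  obtain ⟨r1, e1⟩ := mem_W_dist hab h.left
  obtain ⟨r2, e2⟩ := mem_W_dist hab.symm h.right
  have e3 := h.dist_eq hab
  have rb : G.Reachable w b := r1.trans hab.reachable
  have t1 := dist_triangle_of_reachable hw.reachable b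
  rw [SimpleGraph.dist_eq_one_iff_adj.2 hw] at t1
  have t2 := hG.dist_adj hab (hw.symm.reachable.trans r1)
  have hne : w' ≠ z := by
    rintro rfl
    omega
  obtain ⟨z', hz1, hz2, hz3⟩ := hG.quadrangle hw h.adj hne rb (by omega) (by omega)
  have t3 := dist_triangle_of_reachable hz2.reachable a
  rw [SimpleGraph.dist_eq_one_iff_adj.2 hz2] at t3
  refine ⟨z', ⟨hz1, ?_, ?_⟩, hz2⟩
  · simp only [W, Set.mem_ofPred_eq]; omega
  · simp only [W, Set.mem_ofPred_eq]; omega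

/-- Two partners `z`, `z'` would have a common neighbour `y` closer to `b`. Then `w` and `y` are
common neighbours equally close to `a`, hence equal, although their distances to `b` differ. -/
theorem HasMedianComponents.crosses_unique (hG : HasMedianComponents G) {a b w z z' : V}
    (hab : G.Adj a b) (h : Crosses G a b w z) (h' : Crosses G a b w z') : z = z' := by
  by_contra hne
  obtain ⟨r1, e1⟩ := mem_W_dist hab h.left
  obtain ⟨r2, e2⟩ := mem_W_dist hab.symm h.right
  obtain ⟨r3, e3⟩ := mem_W_dist hab.symm h'.right
  have e4 := h.dist_eq hab
  have e5 := h'.dist_eq hab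
  obtain ⟨y, hy1, hy2, hy3⟩ := hG.quadrangle h.adj h'.adj hne (r1.trans hab.reachable)
    (by omega) (by omega)
  have t1 := dist_triangle_of_reachable (hy1.symm.reachable.trans r2) a
  rw [SimpleGraph.dist_eq_one_iff_adj.2 hab.symm] at t1
  have t2 := dist_triangle_of_reachable hy1.reachable a
  rw [SimpleGraph.dist_eq_one_iff_adj.2 hy1] at t2
  have := hG.common_neighbor_unique hne (r2.trans hab.symm.reachable) h.adj.symm h'.adj.symm
    hy1 hy2 (by omega) (by omega) (by omega)
  subst this
  omega

theorem HasMedianComponents.W_subset_of_square (hG : HasMedianComponents G) {a b a' b' : V}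
    (hab : G.Adj a b) (haa' : G.Adj a a') (hbb' : G.Adj b b') (hab' : G.Adj a' b')
    (hne : a ≠ b') (hne' : a' ≠ b) : W G a b ⊆ W G a' b' := by
  intro w hw
  obtain ⟨r, e⟩ := mem_W_dist hab hw
  have t1 := hG.dist_adj haa' r
  have t2 := hG.dist_adj hbb' (r.trans hab.reachable)
  have t3 := hG.dist_adj hab' (r.trans haa'.reachable)
  by_contra hcon
  simp only [W, Set.mem_ofPred_eq] at hcon
  have c1 := G.dist_comm (u := w) (v := a)
  have c2 := G.dist_comm (u := w) (v := b)
  have c3 := G.dist_comm (u := w) (v := a')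
  have c4 := G.dist_comm (u := w) (v := b')
  -- Otherwise parity forces `d(w,b') = d(w,a)`, with `a'` and `b` one step farther, so `a` and `b'`
  -- would be the same common neighbour.
  exact hne (hG.common_neighbor_unique hne' (r.trans haa'.reachable).symm haa'.symm hab.symm
    hab' hbb' (by omega) (by omega) (by omega))

/-- Opposite edges of a square define the same half-spaces; descend the ladder to `ab`. This lets
any crossing edge replace `ab`. -/
theorem HasMedianComponents.W_eq_of_crosses (hG : HasMedianComponents G) {a b w z : V}
    (hab : G.Adj a b) (h : Crosses G a b w z) : W G w z = W G a b := by
  induction hn : G.dist w a generalizing w z with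
  | zero =>
    obtain ⟨r1, e1⟩ := mem_W_dist hab h.left
    obtain ⟨r2, e2⟩ := mem_W_dist hab.symm h.right
    have e3 := h.dist_eq hab
    rw [r1.dist_eq_zero_iff.1 hn, r2.dist_eq_zero_iff.1 (by omega)]
  | succ n ih =>
    obtain ⟨r1, e1⟩ := mem_W_dist hab h.left
    have hne : w ≠ a := by
      rintro rfl
      simp at hn
    obtain ⟨w', hw, hd⟩ := exists_adj_closer r1 hne
    obtain ⟨z', hc, hz⟩ := hG.crosses_ladder hab h hw hd
    rw [← ih hc (by omega)]
    have n1 : w ≠ z' := by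
      rintro rfl
      exact not_mem_W_of_mem_W_swap hc.right h.left
    have n2 : w' ≠ z := by
      rintro rfl
      exact not_mem_W_of_mem_W_swap h.right hc.left
    exact subset_antisymm (hG.W_subset_of_square h.adj hw hz hc.adj n1 n2)
      (hG.W_subset_of_square hc.adj hw.symm hz.symm h.adj n2 n1)

theorem HasMedianComponents.crosses_iff_of_crosses (hG : HasMedianComponents G)
    {a b w z x y : V} (hab : G.Adj a b) (h : Crosses G a b w z) :
    Crosses G w z x y ↔ Crosses G a b x y := by
  constructor
  · rintro ⟨h1, h2, h3⟩
    rw [hG.W_eq_of_crosses hab h] at h2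
    rw [hG.W_eq_of_crosses hab.symm h.symm] at h3
    exact ⟨h1, h2, h3⟩
  · rintro ⟨h1, h2, h3⟩
    rw [← hG.W_eq_of_crosses hab h] at h2
    rw [← hG.W_eq_of_crosses hab.symm h.symm] at h3
    exact ⟨h1, h2, h3⟩

/-- The matching between `U_{ab}` and `U_{ba}` preserves adjacency. -/
theorem HasMedianComponents.crosses_adj (hG : HasMedianComponents G) {a b w z w' z' : V}
    (hab : G.Adj a b) (h : Crosses G a b w z) (h' : Crosses G a b w' z') (hw : G.Adj w w') :
    G.Adj z z' := by
  have h1 := (hG.crosses_iff_of_crosses hab h').2 h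
  -- Relative to the edge `w'z'`, one ladder step from `wz` arrives at `w'` itself, whose only
  -- partner is `z'`.
  obtain ⟨z'', hc, hz⟩ := hG.crosses_ladder h'.adj h1 hw
    (by rw [SimpleGraph.dist_self, SimpleGraph.dist_eq_one_iff_adj.2 hw])
  rwa [hG.crosses_unique h'.adj hc (Crosses.refl h'.adj)] at hz

/-! ### Convexity of `W_{ab}` and `U_{ab}` -/

/-- A pairwise reachable, interval closed set of vertices. -/
structure IsConvex (G : SimpleGraph V) (S : Set V) : Prop where
  reachable : ∀ u ∈ S, ∀ v ∈ S, G.Reachable u v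
  between : ∀ u ∈ S, ∀ v ∈ S, ∀ x, Between G u x v → x ∈ S

theorem isConvex_of_step {S : Set V} (hr : ∀ u ∈ S, ∀ v ∈ S, G.Reachable u v)
    (hs : ∀ u ∈ S, ∀ v ∈ S, ∀ u', G.Adj u u' → G.dist u' v + 1 = G.dist u v → u' ∈ S) :
    IsConvex G S := by
  refine ⟨hr, ?_⟩
  intro u hu v hv x hx
  induction hn : G.dist u x generalizing u with
  | zero =>
    rwa [← hx.1.dist_eq_zero_iff.1 hn]
  | succ n ih =>
    have hne : u ≠ x := by
      rintro rfl
      simp at hn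
    obtain ⟨u', hu', hd⟩ := exists_adj_closer hx.1 hne
    have e := hx.2.2
    have t1 := dist_triangle_of_reachable hu'.reachable v
    rw [SimpleGraph.dist_eq_one_iff_adj.2 hu'] at t1
    have r : G.Reachable u' x := hu'.symm.reachable.trans hx.1
    have t2 := dist_triangle_of_reachable r v
    exact ih u' (hs u hu v hv u' hu' (by omega)) ⟨r, hx.2.1, by omega⟩ (by omega)

theorem IsConvex.inter {S T : Set V} (hS : IsConvex G S) (hT : IsConvex G T) :
    IsConvex G (S ∩ T) :=
  ⟨fun u hu v hv => hS.reachable u hu.1 v hv.1, fun u hu v hv x hx =>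
    ⟨hS.between u hu.1 v hv.1 x hx, hT.between u hu.2 v hv.2 x hx⟩⟩

/-- If a geodesic towards `v` left along `uu'`, then `W_{uu'} = W_{ab}` would contain `v`, so that
`v` is closer to `u` than to `u'`. -/
theorem HasMedianComponents.isConvex_W (hG : HasMedianComponents G) {a b : V}
    (hab : G.Adj a b) : IsConvex G (W G a b) := by
  refine isConvex_of_step
    (fun u hu v hv => (mem_W_dist hab hu).1.trans (mem_W_dist hab hv).1.symm) ?_
  intro u hu v hv u' huu' hd
  by_contra hcon
  have hc : Crosses G a b u u' := ⟨huu', hu, hG.mem_W_swap_of_adj hab hu huu' hcon⟩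
  rw [← hG.W_eq_of_crosses hab hc] at hv
  have hv : G.dist v u < G.dist v u' := hv
  rw [G.dist_comm, G.dist_comm (u := v)] at hv
  omega

theorem HasMedianComponents.isConvex_U (hG : HasMedianComponents G) {a b : V}
    (hab : G.Adj a b) : IsConvex G (U G a b) := by
  refine isConvex_of_step (fun u hu v hv => (hG.isConvex_W hab).reachable u hu.1 v hv.1) ?_
  intro u hu v hv u' huu' hd
  obtain ⟨z, hz⟩ := mem_U_iff.1 hv
  obtain ⟨y, hy⟩ := mem_U_iff.1 hu
  -- With the crossing edge at `v` as base edge, a step towards `v` is a ladder step.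
  obtain ⟨y', hy', -⟩ :=
    hG.crosses_ladder hz.adj ((hG.crosses_iff_of_crosses hab hz).2 hy) huu' hd
  exact mem_U_iff.2 ⟨y', (hG.crosses_iff_of_crosses hab hz).1 hy'⟩

/-! ### The relation `Θ` and its classes -/

/-- An edge is in relation `Θ` with `ab` iff it joins the two sides of `ab`. -/
theorem HasMedianComponents.theta_iff (hG : HasMedianComponents G) {e f : G.Dart} :
    Theta G e f ↔
      Crosses G e.fst e.snd f.fst f.snd ∨ Crosses G e.fst e.snd f.snd f.fst := by
  have c1 := G.dist_comm (u := e.fst) (v := f.fst)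
  have c2 := G.dist_comm (u := e.fst) (v := f.snd)
  have c3 := G.dist_comm (u := e.snd) (v := f.fst)
  have c4 := G.dist_comm (u := e.snd) (v := f.snd)
  constructor
  · intro h
    unfold Theta at h
    have hr : G.Reachable f.fst e.fst := by
      have e1 := e.adj.reachable
      have e2 := f.adj.reachable
      by_contra hcon
      have h1 : ¬ G.Reachable e.fst f.fst := fun h => hcon h.symm
      have h2 : ¬ G.Reachable e.snd f.snd := fun h => h1 ((e1.trans h).trans e2.symm)
      have h3 : ¬ G.Reachable e.fst f.snd := fun h => h1 (h.trans e2.symm)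
      have h4 : ¬ G.Reachable e.snd f.fst := fun h => h1 (e1.trans h)
      -- Unreachable pairs have the default distance `0`, so all four terms would vanish.
      simp [SimpleGraph.dist_eq_zero_of_not_reachable, h1, h2, h3, h4] at h
    have d1 := hG.dist_adj e.adj hr
    have d2 := hG.dist_adj e.adj (f.adj.symm.reachable.trans hr)
    by_cases hlt : G.dist f.fst e.fst < G.dist f.fst e.snd
    · refine Or.inl ⟨f.adj, hlt, ?_⟩
      simp only [W, Set.mem_ofPred_eq]; omega
    · refine Or.inr ⟨f.adj.symm, ?_, ?_⟩ <;> simp only [W, Set.mem_ofPred_eq] <;> omega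
  · unfold Theta
    rintro (h | h)
    · have h1 : G.dist f.fst e.fst < G.dist f.fst e.snd := h.left
      have h2 : G.dist f.snd e.snd < G.dist f.snd e.fst := h.right
      omega
    · have h1 : G.dist f.snd e.fst < G.dist f.snd e.snd := h.left
      have h2 : G.dist f.fst e.snd < G.dist f.fst e.fst := h.right
      omega

theorem HasMedianComponents.theta_equivalence (hG : HasMedianComponents G) :
    Equivalence (Theta G) where
  refl e := hG.theta_iff.2 (Or.inl (Crosses.refl e.adj))
  symm {e f} h := by
    unfold Theta at h ⊢
    rw [G.dist_comm, G.dist_comm (u := f.snd), G.dist_comm (u := f.fst) (v := e.snd),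
      G.dist_comm (u := f.snd) (v := e.fst)]
    omega
  trans {e f g} h1 h2 := by
    rw [hG.theta_iff] at h1 h2 ⊢
    rcases h1 with h1 | h1
    · rwa [hG.crosses_iff_of_crosses e.adj h1, hG.crosses_iff_of_crosses e.adj h1] at h2
    · have key : ∀ x y, Crosses G f.fst f.snd x y → Crosses G e.fst e.snd y x := fun x y h =>
        (hG.crosses_iff_of_crosses e.adj h1).1 h.symm
      exact h2.symm.imp (key _ _) (key _ _)

/-- The class of an edge is `c` iff the edge joins the two sides of the representative of `c`. -/
theorem HasMedianComponents.mk_eq_iff (hG : HasMedianComponents G) {c : ThetaClass G}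
    {f : G.Dart} : c = Quot.mk _ f ↔
      Crosses G c.rep.fst c.rep.snd f.fst f.snd ∨ Crosses G c.rep.fst c.rep.snd f.snd f.fst := by
  rw [← hG.theta_iff]
  conv_lhs => rw [← Quot.out_eq c]
  exact ⟨fun h => (hG.theta_equivalence.eqvGen_iff).1 (Quot.eqvGen_exact h), Quot.sound⟩

/-! ### The derivative graph has median components -/

theorem derivGraph_reachable_fst {p q : DerivVertex G} (h : (derivGraph G).Reachable p q) :
    p.1 = q.1 := by
  obtain ⟨w⟩ := h
  induction w with
  | nil => rfl
  | cons hadj _ ih => exact hadj.1.trans ih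

/-- The projection of `∂G` to `G`. -/
def derivProj (G : SimpleGraph V) : derivGraph G →g G where
  toFun p := p.2
  map_rel' h := h.2

theorem derivProj_injective_of_fst {p q : DerivVertex G} (h : p.1 = q.1)
    (h' : derivProj G p = derivProj G q) : p = q := by
  obtain ⟨c, x⟩ := p
  obtain ⟨c', y⟩ := q
  obtain rfl : c = c' := h
  exact congrArg (Sigma.mk c) (Subtype.ext h')

theorem derivProj_mem (p : DerivVertex G) :
    derivProj G p ∈ U G p.1.rep.fst p.1.rep.snd := p.2.2

theorem derivGraph_adj {p q : DerivVertex G} :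
    (derivGraph G).Adj p q ↔ p.1 = q.1 ∧ G.Adj (derivProj G p) (derivProj G q) := Iff.rfl

/-- A geodesic of `G` between points of the convex set `U_{ab}` stays inside it, hence lifts to
`∂G`. -/
theorem HasMedianComponents.derivGraph_dist_le (hG : HasMedianComponents G)
    {p q : DerivVertex G} (h : p.1 = q.1) : ∃ w : (derivGraph G).Walk p q,
      w.length ≤ G.dist (derivProj G p) (derivProj G q) := by
  induction hn : G.dist (derivProj G p) (derivProj G q) generalizing p with
  | zero =>
    have hU := hG.isConvex_U q.1.rep.adj
    have hr := hU.reachable _ (h ▸ derivProj_mem p) _ (derivProj_mem q)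
    obtain rfl := derivProj_injective_of_fst h (hr.dist_eq_zero_iff.1 hn)
    exact ⟨.nil, by simp⟩
  | succ n ih =>
    have hU := hG.isConvex_U q.1.rep.adj
    have hr := hU.reachable _ (h ▸ derivProj_mem p) _ (derivProj_mem q)
    have hne : derivProj G p ≠ derivProj G q := by
      intro h
      rw [h, SimpleGraph.dist_self] at hn
      omega
    obtain ⟨u, hu, hd⟩ := exists_adj_closer hr hne
    have hu1 := SimpleGraph.dist_eq_one_iff_adj.2 hu
    have huU : u ∈ U G q.1.rep.fst q.1.rep.snd :=
      hU.between _ (h ▸ derivProj_mem p) _ (derivProj_mem q) u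
        ⟨hu.reachable, hu.symm.reachable.trans hr, by omega⟩
    let p' : DerivVertex G := ⟨q.1, ⟨u, huU⟩⟩
    have hp' : derivProj G p' = u := rfl
    obtain ⟨w, hw⟩ := ih (p := p') rfl (by rw [hp']; omega)
    have hadj : (CubePolynomial.derivGraph G).Adj p p' := derivGraph_adj.2 ⟨h, hu⟩
    exact ⟨.cons hadj w, by simpa using hw⟩

theorem HasMedianComponents.derivGraph_dist (hG : HasMedianComponents G)
    {p q : DerivVertex G} (h : p.1 = q.1) :
    (derivGraph G).dist p q = G.dist (derivProj G p) (derivProj G q) := by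
  obtain ⟨w, hw⟩ := hG.derivGraph_dist_le h
  have h1 := SimpleGraph.dist_le w
  obtain ⟨w', hw'⟩ := SimpleGraph.Reachable.exists_walk_length_eq_dist ⟨w⟩
  have h2 := SimpleGraph.dist_le (w'.map (derivProj G))
  rw [SimpleGraph.Walk.length_map] at h2
  omega

theorem HasMedianComponents.derivGraph_between (hG : HasMedianComponents G)
    {p q m : DerivVertex G} (h : p.1 = q.1) (h' : p.1 = m.1) :
    Between (derivGraph G) p m q ↔
      Between G (derivProj G p) (derivProj G m) (derivProj G q) := by
  unfold Between
  rw [hG.derivGraph_dist h, hG.derivGraph_dist h', hG.derivGraph_dist (h'.symm.trans h)]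
  have r : ∀ {p q : DerivVertex G}, p.1 = q.1 → (derivGraph G).Reachable p q := fun h =>
    ⟨(hG.derivGraph_dist_le h).choose⟩
  have r1 := r h'
  have r2 := r (h'.symm.trans h)
  simp only [r1, r2, r1.map (derivProj G), r2.map (derivProj G), true_and]

theorem HasMedianComponents.derivGraph (hG : HasMedianComponents G) :
    HasMedianComponents (derivGraph G) := by
  intro p q r hpq hpr
  have h1 := derivGraph_reachable_fst hpq
  have h2 := derivGraph_reachable_fst hpr
  have hU := hG.isConvex_U p.1.rep.adj
  obtain ⟨m, ⟨hm1, hm2, hm3⟩, huniq⟩ := hG _ _ _ (hpq.map (derivProj G)) (hpr.map (derivProj G))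
  have hmU := hU.between _ (derivProj_mem p) _ (h1 ▸ derivProj_mem q) m hm1
  let m' : DerivVertex G := ⟨p.1, ⟨m, hmU⟩⟩
  have hm' : p.1 = m'.1 := rfl
  refine ⟨m', ⟨(hG.derivGraph_between h1 hm').2 hm1, (hG.derivGraph_between h2 hm').2 hm2,
    (hG.derivGraph_between (h1.symm.trans h2) (h1.symm.trans hm')).2 hm3⟩, ?_⟩
  rintro n ⟨hn1, hn2, hn3⟩
  have hn : p.1 = n.1 := derivGraph_reachable_fst hn1.1
  exact derivProj_injective_of_fst (hn.symm.trans hm') (huniq _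
    ⟨(hG.derivGraph_between h1 hn).1 hn1, (hG.derivGraph_between h2 hn).1 hn2,
      (hG.derivGraph_between (h1.symm.trans h2) (h1.symm.trans hn)).1 hn3⟩)

/-! ### Induced cubes and coordinates on the hypercube -/

/-- `S` is the vertex set of an induced `n`-cube of `G`. -/
def IsCube (G : SimpleGraph V) (n : ℕ) (S : Set V) : Prop :=
  ∃ f : hypercube n ↪g G, Set.range f = S

theorem isCube_iff {n : ℕ} {S : Set V} :
    Nonempty (G.induce S ≃g hypercube n) ↔ IsCube G n S := by
  constructor
  · rintro ⟨e⟩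
    refine ⟨(SimpleGraph.Embedding.induce S).comp e.symm.toEmbedding, ?_⟩
    ext x
    constructor
    · rintro ⟨y, rfl⟩
      exact (e.symm y).2
    · intro hx
      exact ⟨e ⟨x, hx⟩, by simp⟩
  · rintro ⟨f, rfl⟩
    refine ⟨RelIso.symm ⟨Equiv.ofInjective f f.injective, ?_⟩⟩
    intro x y
    simp

theorem cubeCount_eq (G : SimpleGraph V) (n : ℕ) :
    cubeCount G n = {S : Set V | IsCube G n S}.ncard := by
  simp only [cubeCount, isCube_iff]

theorem IsCube.ncard {n : ℕ} {S : Set V} (h : IsCube G n S) : S.ncard = 2 ^ n := by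
  obtain ⟨f, rfl⟩ := h
  rw [← Set.image_univ, Set.ncard_image_of_injective _ f.injective, Set.ncard_univ]
  simp

theorem IsCube.nonempty {n : ℕ} {S : Set V} (h : IsCube G n S) : S.Nonempty := by
  obtain ⟨f, rfl⟩ := h
  exact Set.range_nonempty f

theorem IsCube.lt_card [Finite V] {n : ℕ} {S : Set V} (h : IsCube G n S) : n < Nat.card V := by
  have h1 := h.ncard
  have h2 := Set.ncard_le_card S
  have h3 := Nat.lt_two_pow_self (n := n)
  omega

/-- The neighbour of `x` in direction `i`. -/
def flip {n : ℕ} (i : Fin n) (x : Fin n → Bool) : Fin n → Bool := Function.update x i (!x i)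

theorem hypercube_adj_iff {n : ℕ} {x y : Fin n → Bool} :
    (hypercube n).Adj x y ↔ ∃ i, y = flip i x := by
  change hammingDist x y = 1 ↔ _
  rw [hammingDist, Finset.card_eq_one]
  refine exists_congr fun i => ?_
  constructor
  · intro h
    funext j
    have hj : x j ≠ y j ↔ j = i := by simpa using Finset.ext_iff.1 h j
    by_cases hji : j = i
    · subst hji
      have := hj.2 rfl
      simp only [flip, Function.update_self]
      cases hx : x j <;> cases hy : y j <;> simp_all
    · simp only [flip, Function.update_of_ne hji]
      by_contra hcon
      exact hji (hj.1 (Ne.symm hcon))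
  · rintro rfl
    ext j
    by_cases hji : j = i
    · subst hji
      rw [Finset.mem_filter]
      simp [flip]
    · rw [Finset.mem_filter]
      simp [flip, hji]

theorem adj_flip {n : ℕ} (i : Fin n) (x : Fin n → Bool) : (hypercube n).Adj x (flip i x) :=
  hypercube_adj_iff.2 ⟨i, rfl⟩

theorem flip_comm {n : ℕ} (i j : Fin n) (x : Fin n → Bool) :
    flip i (flip j x) = flip j (flip i x) := by
  by_cases h : i = j
  · rw [h]
  · simp only [flip, Function.update_of_ne h, Function.update_of_ne (Ne.symm h)]
    exact Function.update_comm (Ne.symm h) _ _ _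

theorem flip_flip {n : ℕ} (i : Fin n) (x : Fin n → Bool) : flip i (flip i x) = x := by
  simp [flip]

theorem flip_ne_flip {n : ℕ} {i j : Fin n} (h : i ≠ j) (x : Fin n → Bool) :
    flip i x ≠ flip j x := by
  intro he
  have := congrFun he i
  simp [flip, h] at this

/-- A property closed under flips that holds at one vertex of the cube holds everywhere. -/
theorem flip_induction {n : ℕ} {P : (Fin n → Bool) → Prop} (hP : ∀ i x, P x → P (flip i x))
    {x : Fin n → Bool} (hx : P x) (y : Fin n → Bool) : P y := by
  classical
  have key : ∀ s : Finset (Fin n), P (fun i => if i ∈ s then y i else x i) := by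
    intro s
    induction s using Finset.induction_on with
    | empty => simpa using hx
    | insert a s ha ih =>
      by_cases hxy : x a = y a
      · convert ih using 2 with i
        by_cases hia : i = a
        · subst hia; simp [ha, hxy]
        · simp [hia]
      · convert hP a _ ih using 1
        funext i
        by_cases hia : i = a
        · subst hia
          simp only [flip, Finset.mem_insert_self, if_true, ha, if_false, Function.update_self]
          cases hx : x i <;> cases hy : y i <;> simp_all
        · simp [flip, hia]
  simpa using key Finset.univ

theorem hypercube_adj_insertNth {n : ℕ} (j : Fin (n + 1)) {s t : Bool} {x y : Fin n → Bool} :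
    (hypercube (n + 1)).Adj (Fin.insertNth j s x : Fin (n + 1) → Bool) (Fin.insertNth j t y) ↔
      (s = t ∧ (hypercube n).Adj x y) ∨ (s ≠ t ∧ x = y) := by
  have key : hammingDist (Fin.insertNth j s x : Fin (n + 1) → Bool) (Fin.insertNth j t y)
      = (if s ≠ t then 1 else 0) + hammingDist x y := by
    simp only [hammingDist, Finset.card_filter]
    rw [Fin.sum_univ_succAbove _ j]
    simp
  change hammingDist _ _ = 1 ↔ (s = t ∧ hammingDist x y = 1) ∨ _
  rw [key]
  by_cases h : s = t
  · simp [h]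
  · simp [h, hammingDist_eq_zero]

/-! ### Cubes and matching cuts -/

/-- The edges leaving `A` form a matching that preserves adjacency. -/
structure MatchingCut (G : SimpleGraph V) (A : Set V) : Prop where
  unique_out : ∀ {x y y'}, x ∈ A → y ∉ A → y' ∉ A → G.Adj x y → G.Adj x y' → y = y'
  unique_in : ∀ {x y y'}, x ∉ A → y ∈ A → y' ∈ A → G.Adj x y → G.Adj x y' → y = y'
  adj_iff : ∀ {x x' y y'}, x ∈ A → x' ∈ A → y ∉ A → y' ∉ A → G.Adj x y → G.Adj x' y' →
    (G.Adj x x' ↔ G.Adj y y')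

/-- The vertices of `A` with a neighbour outside of `A`. -/
def innerBoundary (G : SimpleGraph V) (A : Set V) : Set V := {x | x ∈ A ∧ ∃ y ∉ A, G.Adj x y}

theorem MatchingCut.unique {A : Set V} (hA : MatchingCut G A) {x y y' : V}
    (h : ¬(x ∈ A ↔ y ∈ A)) (h' : ¬(x ∈ A ↔ y' ∈ A)) (hy : G.Adj x y) (hy' : G.Adj x y') :
    y = y' := by
  by_cases hx : x ∈ A
  · exact hA.unique_out hx (by tauto) (by tauto) hy hy'
  · exact hA.unique_in hx (by tauto) (by tauto) hy hy'

/-- A matching cut that separates a cube does so along one direction. -/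
theorem MatchingCut.exists_direction {A : Set V} (hA : MatchingCut G A) {n : ℕ}
    (f : hypercube n ↪g G) (h1 : (Set.range f ∩ A).Nonempty) (h2 : (Set.range f \ A).Nonempty) :
    ∃ (j : Fin n) (s : Bool), ∀ x, f x ∈ A ↔ x j = s := by
  have hadj : ∀ i x, G.Adj (f x) (f (flip i x)) := fun i x => f.map_adj_iff.2 (adj_flip i x)
  obtain ⟨j, x, hx⟩ : ∃ j x, ¬(f x ∈ A ↔ f (flip j x) ∈ A) := by
    by_contra! hcon
    obtain ⟨_, ⟨x, rfl⟩, hx⟩ := h1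
    obtain ⟨_, ⟨y, rfl⟩, hy⟩ := h2
    exact hy (flip_induction (P := fun z => f z ∈ A) (fun i z hz => (hcon i z).1 hz) hx y)
  obtain ⟨s, hs⟩ : ∃ s, f x ∈ A ↔ x j = s := by
    by_cases h : f x ∈ A
    · exact ⟨x j, by simp [h]⟩
    · exact ⟨!x j, by simp [h]⟩
  -- If the edge in direction `i` crossed as well, `f y` would have two partners.
  have hsame : ∀ i y, i ≠ j → ¬(f y ∈ A ↔ f (flip j y) ∈ A) → (f y ∈ A ↔ f (flip i y) ∈ A) := by
    intro i y hij hy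
    by_contra hcon
    exact flip_ne_flip hij y (f.injective (hA.unique hcon hy (hadj i y) (hadj j y)))
  -- The invariant includes that the edge in direction `j` crosses; this is what keeps flips in
  -- other directions on their side.
  refine ⟨j, s, fun y => (flip_induction
    (P := fun z => (f z ∈ A ↔ z j = s) ∧ ¬(f z ∈ A ↔ f (flip j z) ∈ A)) ?_ ⟨hs, hx⟩ y).1⟩
  rintro i z ⟨hz1, hz2⟩
  by_cases hij : i = j
  · subst hij
    rw [flip_flip]
    have : flip i z i = !z i := by simp [flip]
    rw [this]
    refine ⟨?_, by tauto⟩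
    cases hzi : z i <;> cases hs' : s <;> simp_all
  · have e1 := hsame i z hij hz2
    have e2 := hsame i (flip j z) hij (by rw [flip_flip]; tauto)
    have e3 : flip i z j = z j := by simp [flip, Ne.symm hij]
    rw [flip_comm i j] at e2
    rw [e3]
    tauto

/-- The vertices outside of `A` matched to a vertex of `T`, together with `T`. -/
def prism (G : SimpleGraph V) (A T : Set V) : Set V := T ∪ {y | y ∉ A ∧ ∃ x ∈ T, G.Adj x y}

theorem MatchingCut.isCube_prism {A T : Set V} (hA : MatchingCut G A) {n : ℕ}
    (hT : IsCube G n T) (hTA : T ⊆ innerBoundary G A) : IsCube G (n + 1) (prism G A T) := by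
  obtain ⟨f, rfl⟩ := hT
  have hf : ∀ x, ∃ y, y ∉ A ∧ G.Adj (f x) y := fun x => (hTA ⟨x, rfl⟩).2
  choose g hgA hg using hf
  have hfA : ∀ x, f x ∈ A := fun x => (hTA ⟨x, rfl⟩).1
  have hadj : ∀ x y, G.Adj (g x) (g y) ↔ (hypercube n).Adj x y := fun x y => by
    rw [← hA.adj_iff (hfA x) (hfA y) (hgA x) (hgA y) (hg x) (hg y), f.map_adj_iff]
  have hginj : Function.Injective g := fun x y hxy =>
    f.injective (hA.unique_in (hgA x) (hfA x) (hfA y) (hg x).symm (hxy ▸ (hg y).symm))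
  have hfg : ∀ x y, G.Adj (f x) (g y) ↔ x = y := fun x y =>
    ⟨fun h => hginj (hA.unique_out (hfA x) (hgA x) (hgA y) (hg x) h), fun h => h ▸ hg x⟩
  -- The new coordinate `0` records the side of the cut.
  let F : (Fin (n + 1) → Bool) → V := fun y =>
    if y 0 = true then f (Fin.removeNth 0 y) else g (Fin.removeNth 0 y)
  have hF1 : ∀ x, F (Fin.insertNth 0 true x) = f x := fun x => by simp [F]
  have hF0 : ∀ x, F (Fin.insertNth 0 false x) = g x := fun x => by simp [F]
  have hsurj : ∀ y : Fin (n + 1) → Bool, ∃ s x, y = Fin.insertNth 0 s x := fun y =>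
    ⟨y 0, Fin.removeNth 0 y, (Fin.insertNth_self_removeNth 0 y).symm⟩
  have hne : ∀ x y, f x ≠ g y := fun x y h => hgA y (h ▸ hfA x)
  refine ⟨⟨⟨F, ?_⟩, ?_⟩, ?_⟩
  · intro y y' h
    obtain ⟨s, x, rfl⟩ := hsurj y
    obtain ⟨s', x', rfl⟩ := hsurj y'
    cases s <;> cases s' <;> simp only [hF1, hF0] at h
    · rw [hginj h]
    · exact absurd h.symm (hne _ _)
    · exact absurd h (hne _ _)
    · rw [f.injective h]
  · intro y y'
    obtain ⟨s, x, rfl⟩ := hsurj y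
    obtain ⟨s', x', rfl⟩ := hsurj y'
    rw [hypercube_adj_insertNth]
    change G.Adj (F _) (F _) ↔ _
    cases s <;> cases s' <;> simp only [hF1, hF0]
    · simp [hadj]
    · rw [G.adj_comm, hfg]; simp [eq_comm]
    · rw [hfg]; simp
    · simp
  · ext v
    constructor
    · rintro ⟨y, rfl⟩
      obtain ⟨s, x, rfl⟩ := hsurj y
      cases s
      · have e := hF0 x
        refine Or.inr ⟨fun h => hgA x (e ▸ h), f x, ⟨x, rfl⟩, ?_⟩
        change G.Adj (f x) (F (Fin.insertNth 0 false x))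
        rw [e]
        exact hg x
      · exact Or.inl ⟨x, (hF1 x).symm⟩
    · rintro (⟨x, rfl⟩ | ⟨hv, _, ⟨x, rfl⟩, hx⟩)
      · exact ⟨Fin.insertNth 0 true x, hF1 x⟩
      · exact ⟨Fin.insertNth 0 false x, (hF0 x).trans
          (hA.unique_out (hfA x) (hgA x) hv (hg x) hx)⟩

theorem prism_inter {A T : Set V} (hT : T ⊆ A) : prism G A T ∩ A = T := by
  ext x
  constructor
  · rintro ⟨h | h, hx⟩
    · exact h
    · exact absurd hx h.1
  · exact fun h => ⟨Or.inl h, hT h⟩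

/-- The cut is a coordinate hyperplane of the cube, so `S ∩ A` is a facet and the rest consists of
its partners. This inverts the prism construction. -/
theorem MatchingCut.isCube_inter {A S : Set V} (hA : MatchingCut G A) {n : ℕ}
    (hS : IsCube G (n + 1) S) (h1 : (S ∩ A).Nonempty) (h2 : (S \ A).Nonempty) :
    IsCube G n (S ∩ A) ∧ S ∩ A ⊆ innerBoundary G A ∧ prism G A (S ∩ A) = S := by
  obtain ⟨f, rfl⟩ := hS
  obtain ⟨j, s, hj⟩ := hA.exists_direction f h1 h2
  have hadj : ∀ x, G.Adj (f x) (f (flip j x)) := fun x => f.map_adj_iff.2 (adj_flip j x)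
  have hflip : ∀ x, (f (flip j x) ∈ A ↔ f x ∉ A) := by
    intro x
    rw [hj, hj]
    have : flip j x j = !x j := by simp [flip]
    rw [this]
    cases x j <;> cases s <;> simp
  refine ⟨⟨⟨⟨fun x => f (Fin.insertNth j s x), ?_⟩, ?_⟩, ?_⟩, ?_, ?_⟩
  · intro x y h
    exact Fin.insertNth_right_injective s (f.injective h)
  · intro x y
    change G.Adj (f _) (f _) ↔ _
    rw [f.map_adj_iff, hypercube_adj_insertNth]
    simp
  · ext v
    constructor
    · rintro ⟨x, rfl⟩
      refine ⟨⟨_, rfl⟩, (hj _).2 ?_⟩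
      simp
    · rintro ⟨⟨y, rfl⟩, hy⟩
      refine ⟨Fin.removeNth j y, ?_⟩
      have := (hj y).1 hy
      change f _ = _
      rw [← this, Fin.insertNth_self_removeNth]
  · rintro _ ⟨⟨x, rfl⟩, hx⟩
    exact ⟨hx, _, fun h => (hflip x).1 h hx, hadj x⟩
  · ext v
    constructor
    · rintro (h | ⟨hv, _, ⟨⟨x, rfl⟩, hx⟩, hxv⟩)
      · exact h.1
      · exact ⟨_, hA.unique_out hx (fun h => (hflip x).1 h hx) hv (hadj x) hxv⟩
    · rintro ⟨x, rfl⟩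
      by_cases hx : f x ∈ A
      · exact Or.inl ⟨⟨x, rfl⟩, hx⟩
      · exact Or.inr ⟨hx, f (flip j x), ⟨⟨_, rfl⟩, (hflip x).2 hx⟩, (hadj x).symm⟩

/-! ### Counting cubes on and across a cut -/

/-- The `n`-cubes of `G` inside `S`. -/
def cubesIn (G : SimpleGraph V) (n : ℕ) (S : Set V) : Set (Set V) := {T | IsCube G n T ∧ T ⊆ S}

/-- The `n`-cubes of `G` inside `S` that meet both sides of `A`. -/
def cubesAcross (G : SimpleGraph V) (A : Set V) (n : ℕ) (S : Set V) : Set (Set V) :=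
  {T | T ∈ cubesIn G n S ∧ (T ∩ A).Nonempty ∧ (T \ A).Nonempty}

theorem MatchingCut.ncard_cubesAcross {A S : Set V} (hA : MatchingCut G A)
    (hS : ∀ x ∈ S ∩ innerBoundary G A, ∀ y ∉ A, G.Adj x y → y ∈ S) (n : ℕ) :
    (cubesAcross G A (n + 1) S).ncard = (cubesIn G n (S ∩ innerBoundary G A)).ncard := by
  have himg : Set.image (prism G A) (cubesIn G n (S ∩ innerBoundary G A))
      = cubesAcross G A (n + 1) S := by
    ext T
    constructor
    · rintro ⟨T, ⟨hT, hTS⟩, rfl⟩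
      have hTb : T ⊆ innerBoundary G A := fun x hx => (hTS hx).2
      obtain ⟨x, hx⟩ := hT.nonempty
      obtain ⟨hxA, y, hy, hxy⟩ := hTb hx
      refine ⟨⟨hA.isCube_prism hT hTb, ?_⟩, ⟨x, Or.inl hx, hxA⟩, ⟨y, Or.inr ⟨hy, x, hx, hxy⟩, hy⟩⟩
      rintro v (hv | ⟨hv, z, hz, hzv⟩)
      · exact (hTS hv).1
      · exact hS z (hTS hz) v hv hzv
    · rintro ⟨⟨hT, hTS⟩, h1, h2⟩
      obtain ⟨h3, h4, h5⟩ := hA.isCube_inter hT h1 h2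
      exact ⟨T ∩ A, ⟨h3, fun x hx => ⟨hTS hx.1, h4 hx⟩⟩, h5⟩
  rw [← himg, Set.InjOn.ncard_image]
  rintro T ⟨-, hT⟩ T' ⟨-, hT'⟩ h
  rw [← prism_inter (G := G) (A := A) (T := T) fun x hx => (hT hx).2.1, h,
    prism_inter fun x hx => (hT' hx).2.1]

theorem ncard_cubesIn_eq [Finite V] (A S : Set V) (n : ℕ) :
    (cubesIn G n S).ncard = (cubesIn G n (S ∩ A)).ncard + (cubesIn G n (S \ A)).ncard
      + (cubesAcross G A n S).ncard := by
  have hU : cubesIn G n S = cubesIn G n (S ∩ A) ∪ cubesIn G n (S \ A) ∪ cubesAcross G A n S := by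
    ext T
    constructor
    · rintro ⟨hT, hTS⟩
      by_cases h1 : (T ∩ A).Nonempty
      · by_cases h2 : (T \ A).Nonempty
        · exact Or.inr ⟨⟨hT, hTS⟩, h1, h2⟩
        · rw [Set.not_nonempty_iff_eq_empty, Set.sdiff_eq_empty] at h2
          exact Or.inl (Or.inl ⟨hT, Set.subset_inter hTS h2⟩)
      · exact Or.inl (Or.inr ⟨hT, fun x hx => ⟨hTS hx, fun hxA => h1 ⟨x, hx, hxA⟩⟩⟩)
    · rintro ((h | h) | h)
      · exact ⟨h.1, fun x hx => (h.2 hx).1⟩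
      · exact ⟨h.1, fun x hx => (h.2 hx).1⟩
      · exact h.1
  rw [hU, Set.ncard_union_eq, Set.ncard_union_eq]
  · rw [Set.disjoint_left]
    rintro T ⟨hT, h⟩ ⟨-, h'⟩
    obtain ⟨x, hx⟩ := hT.nonempty
    exact (h' hx).2 (h hx).2
  · rw [Set.disjoint_left]
    rintro T (⟨-, h⟩ | ⟨-, h⟩) ⟨-, ⟨x, hx⟩, ⟨y, hy⟩⟩
    · exact hy.2 (h hy.1).2
    · exact (h hx.1).2 hx.2

theorem HasMedianComponents.innerBoundary_W (hG : HasMedianComponents G) {a b : V}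
    (hab : G.Adj a b) : innerBoundary G (W G a b) = U G a b := by
  ext x
  constructor
  · rintro ⟨hx, y, hy, hxy⟩
    exact ⟨hx, y, hG.mem_W_swap_of_adj hab hx hxy hy, hxy⟩
  · rintro ⟨hx, y, hy, hxy⟩
    exact ⟨hx, y, not_mem_W_of_mem_W_swap hy, hxy⟩

theorem HasMedianComponents.matchingCut_W (hG : HasMedianComponents G) {a b : V}
    (hab : G.Adj a b) : MatchingCut G (W G a b) := by
  have hc : ∀ {x y}, x ∈ W G a b → y ∉ W G a b → G.Adj x y → Crosses G a b x y :=
    fun hx hy hxy => ⟨hxy, hx, hG.mem_W_swap_of_adj hab hx hxy hy⟩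
  refine ⟨fun hx hy hy' h h' => hG.crosses_unique hab (hc hx hy h) (hc hx hy' h'),
    fun hx hy hy' h h' => hG.crosses_unique hab.symm (hc hy hx h.symm).symm
      (hc hy' hx h'.symm).symm, fun hx hx' hy hy' h h' => ?_⟩
  exact ⟨hG.crosses_adj hab (hc hx hy h) (hc hx' hy' h'),
    hG.crosses_adj hab.symm (hc hx hy h).symm (hc hx' hy' h').symm⟩

theorem cubesIn_eq_empty [Finite V] {n : ℕ} (hn : Nat.card V ≤ n) (S : Set V) :
    cubesIn G n S = ∅ :=
  Set.eq_empty_of_forall_notMem fun _ hT => absurd hT.1.lt_card (by omega)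

theorem cubesAcross_zero (A S : Set V) : cubesAcross G A 0 S = ∅ := by
  refine Set.eq_empty_of_forall_notMem ?_
  rintro T ⟨⟨⟨f, rfl⟩, -⟩, ⟨_, ⟨x, rfl⟩, hx⟩, ⟨_, ⟨y, rfl⟩, hy⟩⟩
  exact hy (Subsingleton.elim x y ▸ hx)

theorem cubesIn_zero_singleton (v : V) : cubesIn G 0 {v} = {{v}} := by
  ext T
  rw [Set.mem_singleton_iff]
  constructor
  · rintro ⟨hT, hTv⟩
    exact (Set.subset_singleton_iff_eq.1 hTv).resolve_left hT.nonempty.ne_empty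
  · rintro rfl
    refine ⟨⟨⟨⟨fun _ => v, fun x y _ => Subsingleton.elim x y⟩, ?_⟩, ?_⟩, subset_rfl⟩
    · intro x y
      rw [Subsingleton.elim x y]
      simp
    · exact Set.range_const

theorem cubesIn_succ_singleton (n : ℕ) (v : V) : cubesIn G (n + 1) {v} = ∅ := by
  refine Set.eq_empty_of_forall_notMem fun T hT => ?_
  have h1 := Set.ncard_le_ncard hT.2
  rw [hT.1.ncard, Set.ncard_singleton, pow_succ] at h1
  have := Nat.one_le_two_pow (n := n)
  omega

/-! ### Euler characteristic and the value at `-1` -/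

/-- The Euler characteristic of the cube complex of the subgraph induced by `S`. -/
noncomputable def eulerChar (G : SimpleGraph V) (S : Set V) : ℚ :=
  ∑ n ∈ Finset.range (Nat.card V + 1), (-1) ^ n * ((cubesIn G n S).ncard : ℚ)

theorem eulerChar_singleton (v : V) : eulerChar G {v} = 1 := by
  simp [eulerChar, Finset.sum_range_succ', cubesIn_zero_singleton, cubesIn_succ_singleton]

/-- Cubes across the cut are prisms over cubes of the inner boundary; the shift in dimension
reverses their sign. -/
theorem MatchingCut.eulerChar_eq [Finite V] {A S : Set V} (hA : MatchingCut G A)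
    (hS : ∀ x ∈ S ∩ innerBoundary G A, ∀ y ∉ A, G.Adj x y → y ∈ S) :
    eulerChar G S = eulerChar G (S ∩ A) + eulerChar G (S \ A)
      - eulerChar G (S ∩ innerBoundary G A) := by
  have h1 : eulerChar G S = eulerChar G (S ∩ A) + eulerChar G (S \ A)
      + ∑ n ∈ Finset.range (Nat.card V + 1), (-1) ^ n * ((cubesAcross G A n S).ncard : ℚ) := by
    simp only [eulerChar, ← Finset.sum_add_distrib]
    refine Finset.sum_congr rfl fun n _ => ?_
    rw [ncard_cubesIn_eq A S n]
    push_cast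
    ring
  have h2 : ∑ n ∈ Finset.range (Nat.card V + 1), (-1) ^ n * ((cubesAcross G A n S).ncard : ℚ)
      = - eulerChar G (S ∩ innerBoundary G A) := by
    -- The index shift is exact: no `0`-cube crosses the cut, and no cube has dimension `Nat.card
    -- V`.
    rw [Finset.sum_range_succ', eulerChar, Finset.sum_range_succ, cubesIn_eq_empty le_rfl,
      cubesAcross_zero]
    simp only [hA.ncard_cubesAcross hS, Set.ncard_empty, Nat.cast_zero, mul_zero, add_zero,
      ← Finset.sum_neg_distrib]
    exact Finset.sum_congr rfl fun n _ => by ring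
  rw [h1, h2, sub_eq_add_neg]

/-- The cube complex of a nonempty convex set has Euler characteristic one. -/
theorem HasMedianComponents.eulerChar_eq_one [Finite V] (hG : HasMedianComponents G) {S : Set V}
    (hS : IsConvex G S) (hne : S.Nonempty) : eulerChar G S = 1 := by
  induction hn : S.ncard using Nat.strong_induction_on generalizing S with
  | _ n ih =>
  obtain ⟨a, ha⟩ := hne
  by_cases hsub : ∀ v ∈ S, v = a
  · rw [Set.eq_singleton_iff_unique_mem.2 ⟨ha, hsub⟩, eulerChar_singleton]
  push Not at hsub
  obtain ⟨v, hv, hva⟩ := hsub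
  have hr := hS.reachable a ha v hv
  -- Choosing `b` on a geodesic inside `S` makes both sides of `ab` meet `S`, so all three pieces
  -- are nonempty and smaller.
  obtain ⟨b, hab, hd⟩ := exists_adj_closer hr (Ne.symm hva)
  have hab1 := SimpleGraph.dist_eq_one_iff_adj.2 hab
  have hb : b ∈ S := hS.between a ha v hv b
    ⟨hab.reachable, hab.symm.reachable.trans hr, by omega⟩
  have hdiff : S \ W G a b = S ∩ W G b a := by
    ext x
    constructor
    · rintro ⟨hx, hxW⟩
      exact ⟨hx, (hG.mem_W_or hab (hS.reachable x hx a ha)).resolve_left hxW⟩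
    · rintro ⟨hx, hxW⟩
      exact ⟨hx, not_mem_W_of_mem_W_swap hxW⟩
  have haW := left_mem_W hab
  have hbW := left_mem_W hab.symm
  have hlt : ∀ {T : Set V} {x : V}, x ∈ S → x ∉ T → (S ∩ T).ncard < n := fun hx hxT => by
    rw [← hn]
    exact Set.ncard_lt_ncard
      (Set.ssubset_iff_of_subset Set.inter_subset_left |>.2 ⟨_, hx, fun h => hxT h.2⟩)
  rw [(hG.matchingCut_W hab).eulerChar_eq, hG.innerBoundary_W hab, hdiff,
    ih _ (hlt hb (not_mem_W_of_mem_W_swap hbW)) (hS.inter (hG.isConvex_W hab)) ⟨a, ha, haW⟩ rfl,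
    ih _ (hlt ha (not_mem_W_of_mem_W_swap haW)) (hS.inter (hG.isConvex_W hab.symm))
      ⟨b, hb, hbW⟩ rfl,
    ih _ (hlt hb fun h => not_mem_W_of_mem_W_swap hbW h.1) (hS.inter (hG.isConvex_U hab))
      ⟨a, ha, haW, b, hbW, hab⟩ rfl]
  · norm_num
  · rintro x ⟨hx, hxW, -⟩ y hy hxy
    have hc : Crosses G a b x y := ⟨hxy, hxW, hG.mem_W_swap_of_adj hab hxW hxy hy⟩
    obtain ⟨r1, e1⟩ := mem_W_dist hab hc.left
    have e2 := hc.dist_eq hab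
    have hxy1 := SimpleGraph.dist_eq_one_iff_adj.2 hxy
    -- The partner `y` of `x` lies on a geodesic from `x` to `b`.
    exact hS.between x hx b hb y
      ⟨hxy.reachable, hxy.symm.reachable.trans (r1.trans hab.reachable), by omega⟩

theorem isConvex_supp (K : G.ConnectedComponent) : IsConvex G K.supp := by
  refine ⟨fun u hu v hv => SimpleGraph.ConnectedComponent.exact (Eq.trans hu (Eq.symm hv)), ?_⟩
  intro u hu v _ x hx
  exact (SimpleGraph.ConnectedComponent.sound hx.1.symm).trans hu

theorem cubeCount_eq_sum_components [Finite V] [Fintype G.ConnectedComponent] (n : ℕ) :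
    cubeCount G n = ∑ K : G.ConnectedComponent, (cubesIn G n K.supp).ncard := by
  simp only [cubeCount_eq, ← Nat.card_coe_set_eq]
  rw [← Nat.card_sigma]
  refine (Nat.card_eq_of_bijective (fun p => ⟨p.2.1, p.2.2.1⟩) ⟨?_, ?_⟩).symm
  · rintro ⟨K, T, hT, hTK⟩ ⟨K', T', hT', hTK'⟩ h
    obtain rfl : T = T' := congrArg Subtype.val h
    obtain ⟨x, hx⟩ := hT.nonempty
    obtain rfl : K = K' := Eq.trans (Eq.symm (hTK hx)) (hTK' hx)
    rfl
  · rintro ⟨T, hT⟩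
    refine ⟨⟨G.connectedComponentMk (hT.choose fun _ => false), ⟨T, hT, ?_⟩⟩, rfl⟩
    intro y hy
    rw [← hT.choose_spec] at hy
    obtain ⟨x, rfl⟩ := hy
    -- A cube is connected, so it stays in the component of its all-`false` corner.
    refine flip_induction (P := fun x => hT.choose x ∈ SimpleGraph.ConnectedComponent.supp _)
      ?_ (x := fun _ => false) rfl x
    intro i z hz
    exact (SimpleGraph.ConnectedComponent.sound
      (hT.choose.map_adj_iff.2 (adj_flip i z)).symm.reachable).trans hz

theorem HasMedianComponents.sum_cubeCount [Finite V] (hG : HasMedianComponents G) :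
    ∑ n ∈ Finset.range (Nat.card V + 1), (-1) ^ n * (cubeCount G n : ℚ)
      = Nat.card G.ConnectedComponent := by
  have : Fintype G.ConnectedComponent := Fintype.ofFinite _
  simp only [cubeCount_eq_sum_components, Nat.cast_sum, Finset.mul_sum]
  rw [Finset.sum_comm]
  have h : ∀ K : G.ConnectedComponent, eulerChar G K.supp = 1 := fun K =>
    hG.eulerChar_eq_one (isConvex_supp K) K.nonempty_supp
  simp only [eulerChar] at h
  simp [h]

/-! ### The derivative of the cube polynomial -/

instance finite_thetaClass [Finite V] : Finite (ThetaClass G) := by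
  have : Finite G.Dart :=
    Finite.of_injective (fun d => d.toProd) SimpleGraph.Dart.toProd_injective
  exact inferInstanceAs (Finite (Quot _))

instance finite_derivVertex [Finite V] : Finite (DerivVertex G) :=
  inferInstanceAs (Finite (Sigma _))

/-- The side of the `Θ`-class `c` at the origin of its representative. -/
noncomputable def ThetaClass.side (c : ThetaClass G) : Set V := W G c.rep.fst c.rep.snd

/-- The origin side of the edges in the `Θ`-class `c`. -/
noncomputable def ThetaClass.rim (c : ThetaClass G) : Set V := U G c.rep.fst c.rep.snd

theorem HasMedianComponents.mk_eq_iff_side (hG : HasMedianComponents G) {c : ThetaClass G}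
    {f : G.Dart} : c = Quot.mk _ f ↔ ¬(f.fst ∈ c.side ↔ f.snd ∈ c.side) := by
  rw [hG.mk_eq_iff]
  constructor
  · rintro (h | h)
    · exact fun h' => not_mem_W_of_mem_W_swap h.right (h'.1 h.left)
    · exact fun h' => not_mem_W_of_mem_W_swap h.right (h'.2 h.left)
  · intro h
    by_cases h1 : f.fst ∈ c.side
    · have h2 : f.snd ∉ c.side := by tauto
      exact Or.inl ⟨f.adj, h1, hG.mem_W_swap_of_adj c.rep.adj h1 f.adj h2⟩
    · have h2 : f.snd ∈ c.side := by tauto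
      exact Or.inr ⟨f.adj.symm, h2, hG.mem_W_swap_of_adj c.rep.adj h2 f.adj.symm h1⟩

/-- Edges at one corner represent the splitting classes: two in one class would violate the matching
property, and a class splitting the cube does so along a direction `j`, hence contains the corner's
edge in direction `j`. -/
theorem HasMedianComponents.card_classes_across (hG : HasMedianComponents G) {n : ℕ} {S : Set V}
    (hS : IsCube G n S) :
    Nat.card {c : ThetaClass G // (S ∩ c.side).Nonempty ∧ (S \ c.side).Nonempty} = n := by
  obtain ⟨f, rfl⟩ := hS
  let x₀ : Fin n → Bool := fun _ => false
  let δ : Fin n → G.Dart := fun j =>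
    ⟨(f x₀, f (flip j x₀)), f.map_adj_iff.2 (adj_flip j x₀)⟩
  have hcut : ∀ c : ThetaClass G, MatchingCut G c.side := fun c => hG.matchingCut_W c.rep.adj
  have hacross : ∀ {c : ThetaClass G} {j}, c = Quot.mk _ (δ j) →
      (Set.range f ∩ c.side).Nonempty ∧ (Set.range f \ c.side).Nonempty := by
    intro c j h
    have h : ¬(f x₀ ∈ c.side ↔ f (flip j x₀) ∈ c.side) := hG.mk_eq_iff_side.1 h
    by_cases h1 : f x₀ ∈ c.side
    · exact ⟨⟨_, ⟨_, rfl⟩, h1⟩, ⟨f (flip j x₀), ⟨_, rfl⟩, by tauto⟩⟩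
    · exact ⟨⟨f (flip j x₀), ⟨_, rfl⟩, by tauto⟩, ⟨_, ⟨_, rfl⟩, h1⟩⟩
  have := Nat.card_eq_of_bijective (α := Fin n)
    (β := {c : ThetaClass G // (Set.range f ∩ c.side).Nonempty ∧ (Set.range f \ c.side).Nonempty})
    (fun j => ⟨Quot.mk _ (δ j), hacross rfl⟩) ⟨?_, ?_⟩
  · rw [← this, Nat.card_fin]
  · intro j k h
    have h : (Quot.mk _ (δ j) : ThetaClass G) = Quot.mk _ (δ k) := congrArg Subtype.val h
    by_contra hjk
    exact flip_ne_flip hjk x₀ (f.injective ((hcut (Quot.mk _ (δ j))).unique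
      (hG.mk_eq_iff_side.1 rfl) (hG.mk_eq_iff_side.1 h) (δ j).adj (δ k).adj))
  · rintro ⟨c, h1, h2⟩
    obtain ⟨j, s, hj⟩ := (hcut c).exists_direction f h1 h2
    refine ⟨j, Subtype.ext (Eq.symm (hG.mk_eq_iff_side.2 ?_))⟩
    change ¬(f x₀ ∈ c.side ↔ f (flip j x₀) ∈ c.side)
    rw [hj, hj]
    have : flip j x₀ j = !x₀ j := by simp [flip]
    rw [this]
    cases x₀ j <;> cases s <;> simp

theorem cubeCount_derivGraph_eq_sum [Finite V] [Fintype (ThetaClass G)] (n : ℕ) :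
    cubeCount (derivGraph G) n = ∑ c : ThetaClass G, (cubesIn G n c.rim).ncard := by
  simp only [cubeCount_eq, ← Nat.card_coe_set_eq]
  rw [← Nat.card_sigma]
  have hlift : ∀ (c : ThetaClass G) (T : Set V), T ∈ cubesIn G n c.rim →
      IsCube (derivGraph G) n {p | p.1 = c ∧ derivProj G p ∈ T} := by
    rintro c _ ⟨⟨f, rfl⟩, hT⟩
    let F : (Fin n → Bool) → DerivVertex G := fun x => ⟨c, ⟨f x, hT ⟨x, rfl⟩⟩⟩
    have hF : ∀ x, derivProj G (F x) = f x := fun _ => rfl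
    have hF1 : ∀ x, (F x).1 = c := fun _ => rfl
    refine ⟨⟨⟨F, fun x y h => f.injective ?_⟩, fun {x y} => ?_⟩, ?_⟩
    · rw [← hF, h, hF]
    · change (derivGraph G).Adj (F x) (F y) ↔ _
      rw [derivGraph_adj, hF, hF, f.map_adj_iff]
      simp [hF1]
    · ext p
      constructor
      · rintro ⟨x, rfl⟩
        exact ⟨rfl, x, rfl⟩
      · rintro ⟨hp, x, hx⟩
        exact ⟨x, derivProj_injective_of_fst hp.symm hx⟩
  refine (Nat.card_eq_of_bijective (fun p => ⟨_, hlift p.1 p.2.1 p.2.2⟩) ⟨?_, ?_⟩).symm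
  · rintro ⟨c, T, hT⟩ ⟨c', T', hT'⟩ h
    have h : {p : DerivVertex G | p.1 = c ∧ derivProj G p ∈ T}
      = {p | p.1 = c' ∧ derivProj G p ∈ T'} := congrArg Subtype.val h
    obtain ⟨x, hx⟩ := hT.1.nonempty
    have hc : c = c' := ((Set.ext_iff.1 h ⟨c, ⟨x, hT.2 hx⟩⟩).1 ⟨rfl, hx⟩).1
    subst hc
    obtain rfl : T = T' := by
      ext y
      constructor
      · exact fun hy => ((Set.ext_iff.1 h ⟨c, ⟨y, hT.2 hy⟩⟩).1 ⟨rfl, hy⟩).2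
      · exact fun hy => ((Set.ext_iff.1 h ⟨c, ⟨y, hT'.2 hy⟩⟩).2 ⟨rfl, hy⟩).2
    rfl
  · rintro ⟨_, f, rfl⟩
    -- Connectedness puts a cube of `∂G` over a single class, where the projection is an induced
    -- embedding.
    have hf1 : ∀ x, (f x).1 = (f fun _ => false).1 := fun x =>
      flip_induction (P := fun x => (f x).1 = (f fun _ => false).1)
        (fun i z hz => ((f.map_adj_iff.2 (adj_flip i z)).1).symm.trans hz) rfl x
    let F : hypercube n ↪g G := ⟨⟨fun x => derivProj G (f x), fun x y h =>
      f.injective (derivProj_injective_of_fst ((hf1 x).trans (hf1 y).symm) h)⟩, fun {x y} => by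
        rw [← f.map_adj_iff, derivGraph_adj]
        exact ⟨fun h => ⟨(hf1 x).trans (hf1 y).symm, h⟩, fun h => h.2⟩⟩
    refine ⟨⟨(f fun _ => false).1, Set.range F, ⟨F, rfl⟩, ?_⟩, Subtype.ext ?_⟩
    · rintro _ ⟨x, rfl⟩
      have := derivProj_mem (f x)
      rw [hf1 x] at this
      exact this
    · ext p
      constructor
      · rintro ⟨hp, x, hx⟩
        exact ⟨x, derivProj_injective_of_fst ((hf1 x).trans hp.symm) hx⟩
      · rintro ⟨x, rfl⟩
        exact ⟨hf1 x, x, rfl⟩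

/-- Every `(n + 1)`-cube of `G` yields `n + 1` cubes of dimension `n` in `∂G`. -/
theorem HasMedianComponents.cubeCount_derivGraph [Finite V] (hG : HasMedianComponents G) (n : ℕ) :
    cubeCount (CubePolynomial.derivGraph G) n = (n + 1) * cubeCount G (n + 1) := by
  have : Fintype (ThetaClass G) := Fintype.ofFinite _
  have : Fintype {S : Set V | IsCube G (n + 1) S} := Fintype.ofFinite _
  have h1 : ∀ c : ThetaClass G, (cubesIn G n c.rim).ncard
      = (cubesAcross G c.side (n + 1) Set.univ).ncard := by
    intro c
    have hcut : MatchingCut G c.side := hG.matchingCut_W c.rep.adj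
    rw [hcut.ncard_cubesAcross (fun _ _ _ _ _ => Set.mem_univ _), Set.univ_inter]
    exact congrArg (fun S => (cubesIn G n S).ncard) (hG.innerBoundary_W c.rep.adj).symm
  rw [cubeCount_derivGraph_eq_sum, Finset.sum_congr rfl fun c _ => h1 c]
  simp only [← Nat.card_coe_set_eq]
  rw [← Nat.card_sigma]
  -- Double counting of the pairs (class, cube split by that class).
  let e : (Σ c : ThetaClass G, cubesAcross G c.side (n + 1) Set.univ) ≃
      Σ S : {S : Set V | IsCube G (n + 1) S},
        {c : ThetaClass G // (S.1 ∩ c.side).Nonempty ∧ (S.1 \ c.side).Nonempty} :=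
    { toFun := fun p => ⟨⟨p.2.1, p.2.2.1.1⟩, ⟨p.1, p.2.2.2⟩⟩
      invFun := fun p => ⟨p.2.1, ⟨p.1.1, ⟨p.1.2, Set.subset_univ _⟩, p.2.2⟩⟩
      left_inv := fun _ => rfl
      right_inv := fun _ => rfl }
  rw [Nat.card_congr e, Nat.card_sigma,
    Finset.sum_congr rfl fun S _ => hG.card_classes_across S.2, cubeCount_eq,
    ← Nat.card_coe_set_eq]
  simp [mul_comm]

/-! ### Taylor expansion at `-1` -/

theorem cubeCount_eq_zero {n : ℕ} (h : ∀ S, ¬IsCube G n S) : cubeCount G n = 0 := by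
  have : {S : Set V | IsCube G n S} = ∅ := Set.eq_empty_of_forall_notMem h
  rw [cubeCount_eq, this, Set.ncard_empty]

theorem cubePoly_coeff [Finite V] (G : SimpleGraph V) (n : ℕ) :
    (cubePoly G).coeff n = cubeCount G n := by
  simp only [cubePoly, Polynomial.finsetSum_coeff, Polynomial.coeff_monomial]
  rw [Finset.sum_ite_eq']
  split_ifs with h
  · rfl
  · rw [cubeCount_eq_zero, Nat.cast_zero]
    intro S hS
    -- Boundedness is needed because `sSup` of an unbounded set of naturals is `0`.
    refine h (Finset.mem_range.2 (Nat.lt_succ_of_le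
      (le_csSup ⟨Nat.card V, ?_⟩ ⟨S, isCube_iff.2 hS⟩)))
    rintro k ⟨T, hT⟩
    exact (isCube_iff.1 hT).lt_card.le

theorem HasMedianComponents.derivative_cubePoly [Finite V] (hG : HasMedianComponents G) :
    Polynomial.derivative (cubePoly G) = cubePoly (CubePolynomial.derivGraph G) := by
  ext n
  rw [Polynomial.coeff_derivative, cubePoly_coeff, cubePoly_coeff, hG.cubeCount_derivGraph]
  push_cast
  ring

theorem HasMedianComponents.eval_cubePoly [Finite V] (hG : HasMedianComponents G) :
    (cubePoly G).eval (-1) = Nat.card G.ConnectedComponent := by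
  have h : cubePoly G = ∑ n ∈ Finset.range (Nat.card V + 1),
      Polynomial.monomial n (cubeCount G n : ℚ) := by
    ext n
    simp only [cubePoly_coeff, Polynomial.finsetSum_coeff, Polynomial.coeff_monomial]
    rw [Finset.sum_ite_eq']
    split_ifs with h
    · rfl
    · rw [cubeCount_eq_zero, Nat.cast_zero]
      intro S hS
      have := hS.lt_card
      rw [Finset.mem_range] at h
      omega
  rw [h, Polynomial.eval_finsetSum, ← hG.sum_cubeCount]
  refine Finset.sum_congr rfl fun n _ => ?_
  rw [Polynomial.eval_monomial, mul_comm]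

theorem HasMedianComponents.iterDeriv (hG : HasMedianComponents G) (i : ℕ) :
    HasMedianComponents (iterDeriv G i).2 := by
  induction i with
  | zero => exact hG
  | succ i ih => exact ih.derivGraph

theorem HasMedianComponents.iterate_derivative_cubePoly [Finite V] (hG : HasMedianComponents G)
    (i : ℕ) :
    Polynomial.derivative^[i] (cubePoly G) = cubePoly (CubePolynomial.iterDeriv G i).2 := by
  induction i with
  | zero => rfl
  | succ i ih =>
    have := finite_iterDeriv G i
    rw [Function.iterate_succ_apply', ih, (hG.iterDeriv i).derivative_cubePoly]
    rfl

theorem HasMedianComponents.eval_iterate_derivative [Finite V] (hG : HasMedianComponents G)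
    (i : ℕ) : (Polynomial.derivative^[i] (cubePoly G)).eval (-1) = theta G i := by
  have := finite_iterDeriv G i
  rw [hG.iterate_derivative_cubePoly, (hG.iterDeriv i).eval_cubePoly, theta]

theorem HasMedianComponents.shiftedCoeff_eq [Finite V] (hG : HasMedianComponents G) (i : ℕ) :
    shiftedCoeff G i = (theta G i : ℚ) / (i.factorial : ℚ) := by
  have h : (Polynomial.X - 1 : Polynomial ℚ) = Polynomial.X + Polynomial.C (-1) := by
    simp [sub_eq_add_neg]
  have hi : (i.factorial : ℚ) ≠ 0 := Nat.cast_ne_zero.2 i.factorial_ne_zero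
  -- Substituting `X - 1` is the Taylor shift at `-1`; its coefficients are Hasse derivatives, which
  -- are iterated derivatives divided by `i!`.
  rw [shiftedCoeff, h, ← Polynomial.taylor_apply, Polynomial.taylor_coeff,
    ← hG.eval_iterate_derivative, ← Polynomial.factorial_smul_hasseDeriv]
  simp [hi]

theorem natDegree_cubePoly_le (G : SimpleGraph V) : (cubePoly G).natDegree ≤ cubeDim G := by
  refine Polynomial.natDegree_sum_le_of_forall_le _ _ fun i hi => ?_
  exact (Polynomial.natDegree_monomial_le _).trans (Nat.le_of_lt_succ (Finset.mem_range.1 hi))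

end CubePolynomial

theorem corollary4p11 {V : Type*} [Finite V] (G : SimpleGraph V)
    (hG : CubePolynomial.IsMedian G) :
    (∀ i : ℕ, CubePolynomial.shiftedCoeff G i
        = (CubePolynomial.theta G i : ℚ) / (i.factorial : ℚ)) ∧
    (∀ i : ℕ, CubePolynomial.cubeDim G < i → CubePolynomial.theta G i = 0) ∧
    CubePolynomial.cubePoly G =
      ∑ i ∈ Finset.range (CubePolynomial.cubeDim G + 1),
        Polynomial.C ((CubePolynomial.theta G i : ℚ) / (i.factorial : ℚ)) *
          (Polynomial.X + 1) ^ i := by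
  have hM := hG.hasMedianComponents
  have hdeg := CubePolynomial.natDegree_cubePoly_le G
  refine ⟨hM.shiftedCoeff_eq, fun i hi => ?_, ?_⟩
  · have h := hM.eval_iterate_derivative i
    -- `C(G, x)` has degree at most `cubeDim G`, so its higher derivatives vanish.
    rw [Polynomial.iterate_derivative_eq_zero (by omega), Polynomial.eval_zero] at h
    exact_mod_cast h.symm
  · have h1 : ((CubePolynomial.cubePoly G).comp (Polynomial.X - 1)).natDegree
        < CubePolynomial.cubeDim G + 1 := by
      refine Nat.lt_succ_of_le (Polynomial.natDegree_comp_le.trans ?_)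
      rw [← Polynomial.C_1, Polynomial.natDegree_X_sub_C, mul_one]
      exact hdeg
    have h2 : CubePolynomial.cubePoly G
        = ((CubePolynomial.cubePoly G).comp (Polynomial.X - 1)).comp (Polynomial.X + 1) := by
      rw [Polynomial.comp_assoc]
      simp
    rw [h2, Polynomial.as_sum_range_C_mul_X_pow' _ h1, Polynomial.sum_comp]
    refine Finset.sum_congr rfl fun i _ => ?_
    rw [← hM.shiftedCoeff_eq, CubePolynomial.shiftedCoeff]
    simp
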